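/- Let $S$ be a set and $F(S)$ the free group on $S$. Let $FR(S)=\{a^w : a\in S,\ w\in F(S)\}$ be the set of formal symbols $a^w$ (that is, $S\times F(S)$) with the operation $a^w * b^u := a^{\,w u^{-1} b u}$, and let the free quandle $FQ(S)$ on $S$ be the quotient of $FR(S)$ by the equivalence relation generated by $a^w\sim a^{aw}$ ($a\in S$, $w\in F(S)$), with the induced operation $*$. For an integral domain $R$ (commutative, with unity) and a quandle $Q$, the quandle ring $R[Q]$ is the set of all formal finite $R$-linear combinations of elements of $Q$, with coefficientwise addition and the (in general non-associative) multiplication $$\Big(\sum_i \alpha_i x_i\Big)\Big(\sum_j \beta_j y_j\Big)=\sum_{i,j}\alpha_i\beta_j\,(x_i * y_j).$$ Then for every integral domain $R$ and every set $S$, the quandle ring $R[FQ(S)]$ of the free quandle on $S$ has no zero-divisors: if $u,v\in R[FQ(S)]$ and $uv=0$, then $u=0$ or $v=0$. -/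

import Mathlib

open scoped Quandles

/-- The underlying set of the free rack `FR(S)`: formal symbols `a ^ w` with `a` in `S` and `w` in
the free group `F(S)`. -/
@[ext]
structure FreeRack (S : Type*) where
  /-- the base `a` of the symbol `a ^ w` -/
  base : S
  /-- the exponent `w` of the symbol `a ^ w` -/
  exponent : FreeGroup S

namespace FreeRack

/-- The rack operation `a ^ w * b ^ u = a ^ (w u⁻¹ b u)`. Mathlib lets racks act from the left, so
the product `x * y` of a right-acting rack is written `y ◃ x`. -/
instance instRack (S : Type*) : Rack (FreeRack S) where
  act y x := ⟨x.base, x.exponent * y.exponent⁻¹ * FreeGroup.of y.base * y.exponent⟩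
  self_distrib := by
    intro x y z
    ext
    · rfl
    · simp only
      group
  invAct y x := ⟨x.base, x.exponent * y.exponent⁻¹ * (FreeGroup.of y.base)⁻¹ * y.exponent⟩
  left_inv := by
    intro y x
    ext
    · rfl
    · simp only
      group
  right_inv := by
    intro y x
    ext
    · rfl
    · simp only
      group

/-- The relation `a ^ w ∼ a ^ (a w)`. -/
inductive Rel (S : Type*) : FreeRack S → FreeRack S → Prop
  | intro (a : S) (w : FreeGroup S) : Rel S ⟨a, w⟩ ⟨a, FreeGroup.of a * w⟩

theorem act_rel {S : Type*} (y : FreeRack S) {x x' : FreeRack S} (h : Rel S x x') :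
    Rel S (y ◃ x) (y ◃ x') := by
  obtain ⟨a, w⟩ := h
  have := Rel.intro a (w * y.exponent⁻¹ * FreeGroup.of y.base * y.exponent)
  simpa only [Shelf.act, mul_assoc] using this

theorem invAct_rel {S : Type*} (y : FreeRack S) {x x' : FreeRack S} (h : Rel S x x') :
    Rel S (y ◃⁻¹ x) (y ◃⁻¹ x') := by
  obtain ⟨a, w⟩ := h
  have := Rel.intro a (w * y.exponent⁻¹ * (FreeGroup.of y.base)⁻¹ * y.exponent)
  simpa only [Rack.invAct, mul_assoc] using this

theorem rel_act {S : Type*} {y y' : FreeRack S} (h : Rel S y y') (x : FreeRack S) :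
    y ◃ x = y' ◃ x := by
  obtain ⟨b, u⟩ := h
  ext
  · rfl
  · simp only [Shelf.act]
    group

theorem rel_invAct {S : Type*} {y y' : FreeRack S} (h : Rel S y y') (x : FreeRack S) :
    y ◃⁻¹ x = y' ◃⁻¹ x := by
  obtain ⟨b, u⟩ := h
  ext
  · rfl
  · simp only [Rack.invAct]
    group

end FreeRack

/-- The free quandle `FQ(S)`: the quotient of the free rack `FR(S)` by the equivalence relation
generated by `a ^ w ∼ a ^ (a w)`. -/
def FreeQuandle (S : Type*) : Type _ := Quot (FreeRack.Rel S)

namespace FreeQuandle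

/-- The class in `FQ(S)` of the symbol `a ^ w`. -/
def mk {S : Type*} (x : FreeRack S) : FreeQuandle S := Quot.mk _ x

/-- The operation induced on the quotient by that of the free rack. -/
instance instQuandle (S : Type*) : Quandle (FreeQuandle S) where
  act := Quot.lift₂ (fun y x => mk (y ◃ x)) (fun y _ _ h => Quot.sound (FreeRack.act_rel y h))
    (fun _ _ x h => congrArg mk (FreeRack.rel_act h x))
  self_distrib := by
    rintro ⟨x⟩ ⟨y⟩ ⟨z⟩
    exact congrArg mk Shelf.self_distrib
  invAct := Quot.lift₂ (fun y x => mk (y ◃⁻¹ x))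
    (fun y _ _ h => Quot.sound (FreeRack.invAct_rel y h))
    (fun _ _ x h => congrArg mk (FreeRack.rel_invAct h x))
  left_inv := by
    rintro ⟨y⟩ ⟨x⟩
    exact congrArg mk (Rack.left_inv y x)
  right_inv := by
    rintro ⟨y⟩ ⟨x⟩
    exact congrArg mk (Rack.right_inv y x)
  fix := by
    rintro ⟨a, w⟩
    have e : (⟨a, w⟩ : FreeRack S) ◃ ⟨a, w⟩ = ⟨a, FreeGroup.of a * w⟩ := by
      ext
      · rfl
      · simp only [Shelf.act]
        group
    exact (congrArg mk e).trans (Quot.sound (FreeRack.Rel.intro a w)).symm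

theorem mk_act_mk {S : Type*} (y x : FreeRack S) : mk y ◃ mk x = mk (y ◃ x) := rfl

end FreeQuandle

/-- The quandle ring `R[Q]`: formal finite `R`-linear combinations of elements of `Q`. Its
multiplication, given below, is the bilinear extension of the quandle product `x * y`. -/
def QuandleRing (R Q : Type*) [Semiring R] [Quandle Q] : Type _ := MonoidAlgebra R Q

namespace QuandleRing

/-- The quandle product in right-acting notation: `x * y` is Mathlib's `y ◃ x`. -/
abbrev mulOfQuandle (Q : Type*) [Quandle Q] : Mul Q := ⟨fun x y => y ◃ x⟩

/-- Coefficientwise addition, and the multiplication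
`(∑ αᵢ xᵢ) (∑ βⱼ yⱼ) = ∑ αᵢ βⱼ (xᵢ * yⱼ)`. -/
noncomputable instance instNonUnitalNonAssocRing (R Q : Type*) [Ring R] [Quandle Q] :
    NonUnitalNonAssocRing (QuandleRing R Q) :=
  letI : Mul Q := mulOfQuandle Q
  inferInstanceAs (NonUnitalNonAssocRing (MonoidAlgebra R Q))

/-- The element `α x` of `R[Q]`. -/
noncomputable def single {R Q : Type*} [Semiring R] [Quandle Q] (x : Q) (α : R) :
    QuandleRing R Q := MonoidAlgebra.single x α

theorem single_mul_single {R Q : Type*} [Ring R] [Quandle Q] (x y : Q) (α β : R) :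
    (single x α * single y β : QuandleRing R Q) = single (y ◃ x) (α * β) :=
  letI : Mul Q := mulOfQuandle Q
  MonoidAlgebra.single_mul_single x y α β

end QuandleRing

/-! By `toFreeGroup_injective`, a ^ w ↦ w⁻¹ a w embeds FQ(S) in F(S), and the quandle product
becomes conjugation x * y = y⁻¹ x y. A bi-order on F(S) (`exists_biorder`) makes every x ↦ x * y
strictly increasing. Every y ↦ x * y is injective (`act_left_injective`): if p and q conjugate x to
the same element, p q⁻¹ is conjugate to a power of a generator, and its exponent sum 0 forces p = q.
Hence among products of two finite supports, the one with x maximal in the first and y maximizing x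
* y is attained once (`uniqueProds`), and over a domain its coefficient cannot vanish.

The bi-order comes from the Magnus embedding a ↦ 1 + a into ℤ⟨⟨S⟩⟩: series are compared at the first
word where they differ. -/

/-! ### Noncommutative power series -/

/-- Noncommutative formal power series with integer coefficients in variables indexed by `S`:
functions assigning a coefficient to every word in `S`. -/
@[ext]
structure MagnusSeries (S : Type*) where
  /-- the coefficient of a word -/
  coeff : List S → ℤ

namespace MagnusSeries

variable {S : Type*}

/-- The Cauchy product of two families of coefficients. -/
def conv : (List S → ℤ) → (List S → ℤ) → List S → ℤ
  | f, g, [] => f [] * g []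
  | f, g, a :: w => f [] * g (a :: w) + conv (fun v => f (a :: v)) g w

theorem conv_nil (f g : List S → ℤ) : conv f g [] = f [] * g [] := rfl

theorem conv_cons (f g : List S → ℤ) (a : S) (w : List S) :
    conv f g (a :: w) = f [] * g (a :: w) + conv (fun v => f (a :: v)) g w := rfl

theorem conv_add_left (f g h : List S → ℤ) (w : List S) :
    conv (fun v => f v + g v) h w = conv f h w + conv g h w := by
  induction w generalizing f g with
  | nil => simp only [conv_nil]; ring
  | cons a w ih => simp only [conv_cons, ih]; ring

theorem conv_mul_left (c : ℤ) (f g : List S → ℤ) (w : List S) :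
    conv (fun v => c * f v) g w = c * conv f g w := by
  induction w generalizing f with
  | nil => simp only [conv_nil]; ring
  | cons a w ih => simp only [conv_cons, ih]; ring

theorem conv_zero_left (g : List S → ℤ) (w : List S) : conv (fun _ => 0) g w = 0 := by
  simpa using conv_mul_left 0 (fun _ => 0) g w

theorem conv_assoc (f g h : List S → ℤ) (w : List S) :
    conv (conv f g) h w = conv f (conv g h) w := by
  induction w generalizing f with
  | nil => simp only [conv_nil]; ring
  | cons a w ih => simp only [conv_cons, conv_add_left, conv_mul_left, conv_nil, ih]; ring

/-- The coefficients of the constant series `1`. -/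
def oneCoeff : List S → ℤ
  | [] => 1
  | _ :: _ => 0

theorem conv_one_left (f : List S → ℤ) (w : List S) : conv oneCoeff f w = f w := by
  cases w with
  | nil => simp [conv_nil, oneCoeff]
  | cons a w => simp [conv_cons, oneCoeff, conv_zero_left]

theorem conv_one_right (f : List S → ℤ) (w : List S) : conv f oneCoeff w = f w := by
  induction w generalizing f with
  | nil => simp [conv_nil, oneCoeff]
  | cons a w ih => simp [conv_cons, oneCoeff, ih]

instance : Monoid (MagnusSeries S) where
  one := ⟨oneCoeff⟩
  mul f g := ⟨conv f.coeff g.coeff⟩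
  mul_assoc f g h := MagnusSeries.ext (funext (conv_assoc f.coeff g.coeff h.coeff))
  one_mul f := MagnusSeries.ext (funext (conv_one_left f.coeff))
  mul_one f := MagnusSeries.ext (funext (conv_one_right f.coeff))

theorem coeff_one : (1 : MagnusSeries S).coeff = oneCoeff := rfl

theorem coeff_mul (f g : MagnusSeries S) : (f * g).coeff = conv f.coeff g.coeff := rfl

/-! ### Lowest-degree coefficients of a product -/

theorem conv_eq_of_eqOn_right (k f g : List S → ℤ) (w : List S)
    (h : ∀ v, v.length ≤ w.length → f v = g v) : conv k f w = conv k g w := by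
  induction w generalizing k with
  | nil => simp [conv_nil, h []]
  | cons a w ih =>
    rw [conv_cons, conv_cons, h _ le_rfl, ih]
    intro v hv
    exact h v (hv.trans (by simp))

/-- Only the splitting of `w` that gives `k` the empty word meets a place where `f` and `g` may
differ. -/
theorem conv_sub_conv_right (k f g : List S → ℤ) (w : List S)
    (h : ∀ v, v.length < w.length → f v = g v) :
    conv k g w - conv k f w = k [] * (g w - f w) := by
  cases w with
  | nil => simp only [conv_nil]; ring
  | cons a w =>
    rw [conv_cons, conv_cons, conv_eq_of_eqOn_right _ f g w]
    · ring
    · intro v hv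
      exact h v (by simpa using Nat.lt_succ_of_le hv)

theorem conv_sub_conv_left (k f g : List S → ℤ) (w : List S)
    (h : ∀ v, v.length < w.length → f v = g v) :
    conv g k w - conv f k w = (g w - f w) * k [] := by
  induction w generalizing f g with
  | nil => simp only [conv_nil]; ring
  | cons a w ih =>
    have := ih (fun v => f (a :: v)) (fun v => g (a :: v)) fun v hv => h _ (by simpa using hv)
    rw [conv_cons, conv_cons, h [] (by simp)]
    linarith

/-! ### The units `1 + a` -/

open scoped Classical in
/-- The coefficients of `1 + a`. -/
noncomputable def genCoeff (a : S) : List S → ℤ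
  | [] => 1
  | b :: w => if b = a then oneCoeff w else 0

open scoped Classical in
/-- The coefficients of `(1 + a)⁻¹`. -/
noncomputable def genInvCoeff (a : S) : List S → ℤ
  | [] => 1
  | b :: w => if b = a then -genInvCoeff a w else 0

open scoped Classical in
theorem conv_gen_cons (a b : S) (f : List S → ℤ) (w : List S) :
    conv (genCoeff a) f (b :: w) = f (b :: w) + if b = a then f w else 0 := by
  rw [conv_cons]
  by_cases h : b = a
  · simp [genCoeff, h, conv_one_left]
  · simp [genCoeff, h, conv_zero_left]

theorem conv_gen_genInv (a : S) (w : List S) :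
    conv (genCoeff a) (genInvCoeff a) w = oneCoeff w := by
  cases w with
  | nil => simp [conv_nil, genCoeff, genInvCoeff, oneCoeff]
  | cons b w => by_cases h : b = a <;> simp [conv_gen_cons, genInvCoeff, oneCoeff, h]

theorem conv_genInv_gen (a : S) (w : List S) :
    conv (genInvCoeff a) (genCoeff a) w = oneCoeff w := by
  induction w with
  | nil => simp [conv_nil, genCoeff, genInvCoeff, oneCoeff]
  | cons b w ih =>
    rw [conv_cons]
    by_cases h : b = a
    · have e : conv (fun v => genInvCoeff a (b :: v)) (genCoeff a) w = -oneCoeff w := by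
        rw [← ih, neg_eq_neg_one_mul, ← conv_mul_left]
        simp [genInvCoeff, h]
      rw [e]
      simp [genInvCoeff, genCoeff, oneCoeff, h]
    · simp [genInvCoeff, genCoeff, oneCoeff, h, conv_zero_left]

/-- The unit `1 + a`. -/
noncomputable def genUnit (a : S) : (MagnusSeries S)ˣ where
  val := ⟨genCoeff a⟩
  inv := ⟨genInvCoeff a⟩
  val_inv := MagnusSeries.ext (funext (conv_gen_genInv a))
  inv_val := MagnusSeries.ext (funext (conv_genInv_gen a))

/-- The Magnus representation of the free group, `a ↦ 1 + a`. -/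
noncomputable def magnus : FreeGroup S →* (MagnusSeries S)ˣ := FreeGroup.lift genUnit

theorem coeff_magnus_nil (x : FreeGroup S) : (magnus x : MagnusSeries S).coeff [] = 1 := by
  induction x using FreeGroup.induction_on with
  | C1 => rfl
  | of a => simp [magnus, genUnit, genCoeff]
  | inv_of a _ => simp only [magnus, map_inv, FreeGroup.lift_apply_of]; rfl
  | mul x y hx hy => rw [map_mul, Units.val_mul, coeff_mul, conv_nil, hx, hy, one_mul]

theorem coeff_magnus_mul (x y : FreeGroup S) : (magnus (x * y) : MagnusSeries S).coeff =
    conv (magnus x : MagnusSeries S).coeff (magnus y : MagnusSeries S).coeff := by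
  rw [map_mul, Units.val_mul, coeff_mul]

/-! ### Injectivity of the Magnus representation -/

/-- Words without equal adjacent letters. -/
abbrev Alternating (w : List S) : Prop := w.IsChain (· ≠ ·)

open scoped Classical in
/-- The coefficients of `a * f`. -/
noncomputable def shift (a : S) (f : List S → ℤ) : List S → ℤ
  | [] => 0
  | b :: w => if b = a then f w else 0

/-- No alternating word starts with aa. On such words a² acts as 0, so (1 + a)ⁿ acts as 1 + n a for
every integer n. -/
theorem shift_shift (a : S) (f : List S → ℤ) {w : List S} (hw : Alternating w) :
    shift a (shift a f) w = 0 := by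
  match w, hw with
  | [], _ => rfl
  | [b], _ => simp [shift]
  | b :: c :: w, hw =>
    have : b ≠ c := (List.isChain_cons_cons.1 hw).1
    simp only [shift]
    split_ifs with h1 h2
    · exact absurd (h1.trans h2.symm) this
    · rfl
    · rfl

theorem shift_congr (a : S) {f g : List S → ℤ} (h : ∀ w, Alternating w → f w = g w)
    {w : List S} (hw : Alternating w) : shift a f w = shift a g w := by
  cases w with
  | nil => rfl
  | cons b w => simp only [shift, h w hw.of_cons]

theorem shift_add_mul (a : S) (f g : List S → ℤ) (n : ℤ) (w : List S) :
    shift a (fun v => f v + n * g v) w = shift a f w + n * shift a g w := by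
  cases w with
  | nil => simp [shift]
  | cons b w => by_cases h : b = a <;> simp [shift, h]

theorem conv_gen (a : S) (f : List S → ℤ) (w : List S) :
    conv (genCoeff a) f w = f w + shift a f w := by
  cases w with
  | nil => simp [conv_nil, genCoeff, shift]
  | cons b w => rw [conv_gen_cons, shift]

theorem conv_genInv (a : S) (f : List S → ℤ) {w : List S} (hw : Alternating w) :
    conv (genInvCoeff a) f w = f w - shift a f w := by
  set h := conv (genInvCoeff a) f with hh
  have key (v : List S) : f v = h v + shift a h v := by
    rw [← conv_gen, hh, ← conv_assoc, funext (conv_gen_genInv a), conv_one_left]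
  have : shift a f w = shift a h w := by
    have e : f = fun v => h v + 1 * shift a h v := funext fun v => by rw [one_mul, key]
    rw [e, shift_add_mul, shift_shift a h hw, mul_zero, add_zero]
  rw [this, key]
  ring

/-- The sign of a letter of a word in the free group. -/
def sign (e : Bool) : ℤ := if e then 1 else -1

theorem coeff_magnus_cons (a : S) (e : Bool) (L : List (S × Bool)) {w : List S}
    (hw : Alternating w) :
    (magnus (FreeGroup.mk ((a, e) :: L)) : MagnusSeries S).coeff w =
      (magnus (FreeGroup.mk L) : MagnusSeries S).coeff w +
        sign e * shift a (magnus (FreeGroup.mk L) : MagnusSeries S).coeff w := by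
  have h1 : (FreeGroup.mk ((a, e) :: L)) = FreeGroup.mk [(a, e)] * FreeGroup.mk L := by
    simp [FreeGroup.mul_mk]
  rw [h1, coeff_magnus_mul]
  cases e with
  | true =>
    have : (magnus (FreeGroup.mk [(a, true)]) : MagnusSeries S).coeff = genCoeff a := by
      simp [magnus, genUnit]
    rw [this, conv_gen]
    simp [sign]
  | false =>
    have : (magnus (FreeGroup.mk [(a, false)]) : MagnusSeries S).coeff = genInvCoeff a := by
      simp only [magnus, FreeGroup.lift_mk, List.map_cons, List.map_nil, List.prod_singleton]
      rfl
    rw [this, conv_genInv a _ hw]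
    simp [sign]
    ring

/-- On alternating words, `f` agrees with `(1 + n a) g`, where `n` is nonzero of sign `e`, and some
alternating word of maximal length with nonzero coefficient in `g` does not start with `a`. -/
def HasSyllable (a : S) (e : Bool) (f : List S → ℤ) : Prop :=
  ∃ (n : ℤ) (g : List S → ℤ) (w : List S), 0 < sign e * n ∧ Alternating (a :: w) ∧ g w ≠ 0 ∧
    (∀ v, Alternating v → w.length < v.length → g v = 0) ∧
    ∀ v, Alternating v → f v = g v + n * shift a g v

/-- Grouping a reduced word into syllables a₁^n₁ ⋯ aₖ^nₖ, the coefficient at a₁ ⋯ aₖ is n₁ ⋯ nₖ ≠ 0.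
-/
theorem hasSyllable_magnus (a : S) (e : Bool) (L : List (S × Bool))
    (hL : FreeGroup.IsReduced ((a, e) :: L)) :
    HasSyllable a e (magnus (FreeGroup.mk ((a, e) :: L)) : MagnusSeries S).coeff := by
  have hs : sign e * sign e = 1 := by cases e <;> rfl
  induction L generalizing a e with
  | nil =>
    refine ⟨sign e, oneCoeff, [], by omega, List.isChain_singleton a, by simp [oneCoeff], ?_,
      fun v hv => coeff_magnus_cons a e [] hv⟩
    intro v _ hv
    cases v with
    | nil => simp at hv
    | cons => rfl
  | cons b L ih =>
    obtain ⟨b, d⟩ := b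
    rw [FreeGroup.isReduced_cons_cons] at hL
    obtain ⟨n, g, w, hn, hw, hg, hlong, hf⟩ := ih b d hL.2 (by cases d <;> rfl)
    by_cases hab : a = b
    · obtain rfl : e = d := hL.1 hab
      subst hab
      -- Reducedness gives equal signs, so the exponent of the syllable grows and cannot cancel.
      refine ⟨n + sign e, g, w, by rw [mul_add]; omega, hw, hg, hlong, fun v hv => ?_⟩
      rw [coeff_magnus_cons a e _ hv, hf v hv, shift_congr a hf hv, shift_add_mul,
        shift_shift a g hv]
      ring
    · refine ⟨sign e, _, b :: w, by omega, List.isChain_cons_cons.2 ⟨hab, hw⟩, ?_, ?_,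
        fun v hv => coeff_magnus_cons a e _ hv⟩
      · have : n ≠ 0 := by rintro rfl; simp at hn
        rw [hf _ hw, hlong _ hw (by simp)]
        simp [shift, this, hg]
      · intro v hv hlen
        cases v with
        | nil => simp at hlen
        | cons c v =>
          have hlen' : w.length < v.length := by simpa using hlen
          rw [hf _ hv, hlong _ hv (by simp; omega)]
          simp [shift, hlong v hv.of_cons hlen']

theorem magnus_injective : Function.Injective (magnus : FreeGroup S →* (MagnusSeries S)ˣ) := by
  classical
  rw [injective_iff_map_eq_one]
  intro x hx
  have hred : FreeGroup.IsReduced x.toWord := FreeGroup.isReduced_toWord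
  have hmk : FreeGroup.mk x.toWord = x := FreeGroup.mk_toWord
  cases hL : x.toWord with
  | nil => exact FreeGroup.toWord_eq_nil_iff.1 hL
  | cons p L =>
    obtain ⟨a, e⟩ := p
    rw [hL] at hred hmk
    obtain ⟨n, g, w, hn, hw, hg, hlong, hf⟩ := hasSyllable_magnus a e L hred
    -- The coefficient at `a :: w` is n · g w ≠ 0, whereas the series 1 vanishes on nonempty words.
    have h := hf _ hw
    rw [hmk, hx, hlong _ hw (by simp)] at h
    have : n ≠ 0 := by rintro rfl; simp at hn
    simp [shift, coeff_one, oneCoeff, this, hg] at h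

end MagnusSeries

/-! ### Free groups -/

namespace FreeGroup

open MagnusSeries in
/-- Free groups are bi-orderable. -/
theorem exists_biorder (S : Type*) : ∃ _ : LinearOrder (FreeGroup S),
    ∀ x y z : FreeGroup S, x < y → z * x < z * y ∧ x * z < y * z := by
  classical
  -- A well-order, so a first difference exists; length comes first, so words shorter than it carry
  -- equal coefficients.
  let r : List S → List S → Prop := List.Shortlex WellOrderingRel
  have hwf : WellFounded r := List.Shortlex.wf IsWellFounded.wf
  have : IsWellFounded (List S) r := ⟨hwf⟩
  have : IsWellOrder (List S) r := { }
  let lo : LinearOrder (List S) := IsWellOrder.linearOrder r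
  have : WellFoundedLT (List S) := ⟨hwf⟩
  let φ (x : FreeGroup S) : List S → ℤ := (magnus x : MagnusSeries S).coeff
  let F (x : FreeGroup S) : Lex (List S → ℤ) := toLex (φ x)
  have hF : Function.Injective F := fun x y h =>
    magnus_injective (Units.ext (MagnusSeries.ext h))
  have hlt (x y : FreeGroup S) :
      F x < F y ↔ ∃ w, (∀ v, r v w → φ x v = φ y v) ∧ φ x w < φ y w := Iff.rfl
  refine ⟨LinearOrder.lift' F hF, fun x y z hxy => ?_⟩
  change F x < F y at hxy
  change F (z * x) < F (z * y) ∧ F (x * z) < F (y * z)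
  rw [hlt] at hxy
  obtain ⟨w, hw, hpos⟩ := hxy
  have hshort (u : List S) (hu : u.length ≤ w.length) (v : List S) (hv : v.length < u.length) :
      φ x v = φ y v := hw v (List.Shortlex.of_length_lt (hv.trans_le hu))
  have hlen {u : List S} (hu : r u w) : u.length ≤ w.length := by
    rcases List.shortlex_def.1 hu with h | h
    · exact h.le
    · exact h.1.le
  -- Since `z` has constant term 1, multiplying by it preserves differences up to the length of `w`.
  have hl (u : List S) (hu : u.length ≤ w.length) :
      φ (z * y) u - φ (z * x) u = φ y u - φ x u := by
    simp only [φ, coeff_magnus_mul]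
    rw [conv_sub_conv_right _ _ _ _ (hshort u hu), coeff_magnus_nil, one_mul]
  have hr (u : List S) (hu : u.length ≤ w.length) :
      φ (y * z) u - φ (x * z) u = φ y u - φ x u := by
    simp only [φ, coeff_magnus_mul]
    rw [conv_sub_conv_left _ _ _ _ (hshort u hu), coeff_magnus_nil, mul_one]
  rw [hlt, hlt]
  refine ⟨⟨w, fun v hv => ?_, ?_⟩, ⟨w, fun v hv => ?_, ?_⟩⟩
  · linarith [hl v (hlen hv), hw v hv]
  · linarith [hl w le_rfl]
  · linarith [hr v (hlen hv), hw v hv]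
  · linarith [hr w le_rfl]

/-- The centralizer of a generator consists of its powers. -/
theorem exists_zpow_of_commute {S : Type*} (a : S) (g : FreeGroup S) (h : Commute (of a) g) :
    ∃ n : ℤ, g = of a ^ n := by
  classical
  induction hn : g.toWord.length using Nat.strong_induction_on generalizing g with
  | _ N ih =>
    subst hn
    cases hL : g.toWord with
    | nil => exact ⟨0, by rw [zpow_zero]; exact toWord_eq_nil_iff.1 hL⟩
    | cons p L =>
      obtain ⟨b, e⟩ := p
      have hred : IsReduced ((b, e) :: L) := hL ▸ isReduced_toWord
      have hg : g = mk [(b, e)] * mk L := by rw [mul_mk, List.singleton_append, ← hL, mk_toWord]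
      have hLred : IsReduced L := hred.infix ⟨[(b, e)], [], by simp⟩
      by_cases hb : b = a
      · subst hb
        obtain ⟨k, hk⟩ : ∃ k : ℤ, mk [(b, e)] = of b ^ k := by
          cases e with
          | true => exact ⟨1, by rw [zpow_one]; rfl⟩
          | false => exact ⟨-1, by rw [zpow_neg_one]; rfl⟩
        have hcomm : Commute (of b) (mk L) := by
          have : mk L = (of b ^ k)⁻¹ * g := by rw [hg, hk]; group
          rw [this]
          exact ((Commute.refl (of b)).zpow_right k).inv_right.mul_right h
        obtain ⟨n, hn⟩ := ih _ (by rw [hL, toWord_mk, hLred.reduce_eq]; simp) _ hcomm rfl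
        exact ⟨k + n, by rw [hg, hk, hn, zpow_add]⟩
      · exfalso
        -- No cancellation occurs in a g, so g a has the same full length; comparing first letters
        -- gives b = a.
        have h1 : (of a * g).toWord = (a, true) :: (b, e) :: L := by
          have : of a * g = mk ((a, true) :: (b, e) :: L) := by
            rw [hg, of, mul_mk, mul_mk]; rfl
          rw [this, toWord_mk, IsReduced.reduce_eq]
          exact isReduced_cons_cons.2 ⟨fun h => absurd h.symm hb, hred⟩
        have h2 : (of a * g).toWord.Sublist ((b, e) :: L ++ [(a, true)]) := by
          rw [h.eq, ← hL, ← toWord_of]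
          exact toWord_mul_sublist g (of a)
        rw [h1] at h2
        have h3 := h2.eq_of_length (by simp)
        simp only [List.cons_append, List.cons.injEq, Prod.mk.injEq] at h3
        exact hb h3.1.1.symm

end FreeGroup

/-! ### Free quandles -/

namespace FreeQuandle

variable {S : Type*}

/-- The embedding `a ^ w ↦ w⁻¹ a w` of the free quandle into the free group. -/
def toFreeGroup : FreeQuandle S → FreeGroup S :=
  Quot.lift (fun x => x.exponent⁻¹ * FreeGroup.of x.base * x.exponent) (by
    rintro _ _ ⟨a, w⟩
    group)

theorem toFreeGroup_act (y x : FreeQuandle S) :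
    toFreeGroup (y ◃ x) = (toFreeGroup y)⁻¹ * toFreeGroup x * toFreeGroup y := by
  obtain ⟨x⟩ := x
  obtain ⟨y⟩ := y
  change (_ * _ * _ * _)⁻¹ * FreeGroup.of x.base * (_ * _ * _ * _) =
    (_ * _ * _)⁻¹ * (_ * _ * _) * (_ * _ * _)
  group

theorem mk_zpow_mul (a : S) (w : FreeGroup S) (n : ℤ) :
    mk ⟨a, FreeGroup.of a ^ n * w⟩ = mk ⟨a, w⟩ := by
  have step (m : ℤ) : mk ⟨a, FreeGroup.of a ^ (m + 1) * w⟩ = mk ⟨a, FreeGroup.of a ^ m * w⟩ := by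
    rw [add_comm, zpow_add, zpow_one, mul_assoc]
    exact (Quot.sound (FreeRack.Rel.intro a _)).symm
  induction n with
  | zero => rw [zpow_zero, one_mul]
  | succ i ih => rw [step, ih]
  | pred i ih => rw [← ih, ← step, sub_add_cancel]

open scoped Classical in
-- The exponent sum of the letter `a` is invariant under conjugation.
theorem base_eq_of_conj_eq {a b : S} {w u : FreeGroup S}
    (h : w⁻¹ * FreeGroup.of a * w = u⁻¹ * FreeGroup.of b * u) : a = b := by
  let f : FreeGroup S →* Multiplicative ℤ :=
    FreeGroup.lift fun c => Multiplicative.ofAdd (if c = a then 1 else 0)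
  have := congrArg f h
  simp only [map_mul, map_inv, mul_assoc, mul_comm, mul_inv_cancel_comm_assoc] at this
  by_contra hab
  simp [f, Ne.symm hab] at this

theorem toFreeGroup_injective : Function.Injective (toFreeGroup : FreeQuandle S → FreeGroup S) := by
  rintro ⟨a, w⟩ ⟨b, u⟩ h
  change w⁻¹ * FreeGroup.of a * w = u⁻¹ * FreeGroup.of b * u at h
  obtain rfl : a = b := base_eq_of_conj_eq h
  obtain ⟨n, hn⟩ := FreeGroup.exists_zpow_of_commute a (w * u⁻¹) (by
    calc FreeGroup.of a * (w * u⁻¹) = w * (w⁻¹ * FreeGroup.of a * w) * u⁻¹ := by group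
      _ = w * u⁻¹ * FreeGroup.of a := by rw [h]; group)
  have : w = FreeGroup.of a ^ n * u := by rw [← hn]; group
  rw [this]
  exact mk_zpow_mul a u n

/-- The exponent sum on the free group. -/
def degree : FreeGroup S →* Multiplicative ℤ := FreeGroup.lift fun _ => Multiplicative.ofAdd 1

theorem degree_toFreeGroup (x : FreeQuandle S) :
    degree (toFreeGroup x) = Multiplicative.ofAdd 1 := by
  obtain ⟨a, w⟩ := x
  change degree (w⁻¹ * FreeGroup.of a * w) = _
  rw [map_mul, map_mul, map_inv, mul_right_comm, inv_mul_cancel, one_mul]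
  simp [degree]

/-- The left multiplications `y ↦ x * y` of the free quandle are injective. -/
theorem act_left_injective (x : FreeQuandle S) : Function.Injective fun y => y ◃ x := by
  intro y z h
  have h := congrArg toFreeGroup h
  simp only [toFreeGroup_act] at h
  apply toFreeGroup_injective
  have hy := degree_toFreeGroup y
  have hz := degree_toFreeGroup z
  generalize toFreeGroup y = p at *
  generalize toFreeGroup z = q at *
  obtain ⟨a, w⟩ := x
  change p⁻¹ * (w⁻¹ * FreeGroup.of a * w) * p = q⁻¹ * (w⁻¹ * FreeGroup.of a * w) * q at h
  obtain ⟨n, hn⟩ := FreeGroup.exists_zpow_of_commute a (w * p * q⁻¹ * w⁻¹) (by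
    calc FreeGroup.of a * (w * p * q⁻¹ * w⁻¹)
        = w * p * (p⁻¹ * (w⁻¹ * FreeGroup.of a * w) * p) * q⁻¹ * w⁻¹ := by group
      _ = w * p * q⁻¹ * w⁻¹ * FreeGroup.of a := by rw [h]; group)
  have hdeg := congrArg degree hn
  rw [map_mul, map_mul, map_mul, map_inv, map_inv, hy, hz, mul_inv_cancel_right, mul_inv_cancel,
    map_zpow] at hdeg
  obtain rfl : n = 0 := by
    have := congrArg Multiplicative.toAdd hdeg
    simpa [degree, eq_comm] using this
  rw [zpow_zero] at hn
  calc p = w⁻¹ * (w * p * q⁻¹ * w⁻¹) * w * q := by group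
    _ = q := by rw [hn]; group

/-- Of two nonempty finite subsets of the free quandle, some product is uniquely attained. -/
theorem uniqueProds (S : Type*) :
    @UniqueProds (FreeQuandle S) (QuandleRing.mulOfQuandle (FreeQuandle S)) := by
  let : Mul (FreeQuandle S) := QuandleRing.mulOfQuandle (FreeQuandle S)
  obtain ⟨lo, hlo⟩ := FreeGroup.exists_biorder S
  let : LinearOrder (FreeQuandle S) := LinearOrder.lift' toFreeGroup toFreeGroup_injective
  have hmono (y : FreeQuandle S) : StrictMono fun x => y ◃ x := by
    intro x x' h
    change toFreeGroup (y ◃ x) < toFreeGroup (y ◃ x')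
    rw [toFreeGroup_act, toFreeGroup_act]
    exact (hlo _ _ _ (hlo _ _ _ h).1).2
  refine ⟨fun {A B} hA hB => ?_⟩
  obtain ⟨x, hx, hxmax⟩ := A.exists_max_image id hA
  -- The product is maximized rather than `y`, since y ↦ x * y need not be monotone.
  obtain ⟨y, hy, hymax⟩ := B.exists_max_image (fun y => y ◃ x) hB
  refine ⟨x, hx, y, hy, fun a b ha hb h => ?_⟩
  change b ◃ a = y ◃ x at h
  have h1 : b ◃ a ≤ b ◃ x := (hmono b).monotone (hxmax a ha)
  have h2 : b ◃ x = y ◃ x := le_antisymm (hymax b hb) (h ▸ h1)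
  exact ⟨(hmono b).injective (h.trans h2.symm), act_left_injective x h2⟩

end FreeQuandle

/-- Quandle rings of free quandles over integral domains have no zero-divisors. -/
theorem mainTheorem3 (R : Type*) [CommRing R] [IsDomain R] (S : Type*) :
    NoZeroDivisors (QuandleRing R (FreeQuandle S)) := by
  let : Mul (FreeQuandle S) := QuandleRing.mulOfQuandle (FreeQuandle S)
  have := FreeQuandle.uniqueProds S
  exact inferInstanceAs (NoZeroDivisors (MonoidAlgebra R (FreeQuandle S)))
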